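/- Let $n\ge 0$ be an integer and let $\mathbb{D}^n=\{x\in\mathbb{R}^n:|x|<1\}$ be the open unit ball, equipped with the hyperbolic metric $d_H$ given by the line element $|ds|=2|dz|/(1-|z|^2)$. Let $\mathrm{Con}^+(n)$ be the group of orientation preserving isometries of $(\mathbb{D}^n,d_H)$. A subgroup $\Gamma\le \mathrm{Con}^+(n)$ is called Kleinian if it is discrete (for the topology of uniform convergence on compact sets). For a discrete set $E\subseteq\mathbb{D}^n$ let $L(E)=\overline{E}\setminus E$ be its limit set, where the closure is taken in $\mathbb{R}^n$. A Kleinian group $\Gamma$ is called non-elementary if its limit set $L(\Gamma)=\overline{\Gamma(0)}\setminus\Gamma(0)$ has more than two points. Let $\Gamma$ be a non-elementary Kleinian group and let $z\in\mathbb{D}^n$. Then the orbit $\Gamma(z)=\{g(z):g\in\Gamma\}$ is well-approximated, that is, $\Gamma(z)$ is a discrete subset of $\mathbb{D}^n$ and there is a constant $c\ge 1$ (depending on $\Gamma$ and $z$) such that for every $x\in\Gamma(z)$ there is a point $w\in L(\Gamma(z))$ with $$|x-w|\le c\,(1-|x|).$$ -/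

import Mathlib

/-- The open unit ball `𝔻ⁿ` of Euclidean space `ℝⁿ`, with its Euclidean subspace topology. -/
abbrev PoincareBall (n : ℕ) : Type :=
  ↥(Metric.ball (0 : EuclideanSpace ℝ (Fin n)) 1)

/-- The length of the path `γ : [0,1] → 𝔻ⁿ` for the line element `|ds| = 2|dz| / (1 - |z|²)`. -/
noncomputable def hypLength {n : ℕ} (γ : ℝ → EuclideanSpace ℝ (Fin n)) : ℝ :=
  ∫ t in (0 : ℝ)..1, 2 * ‖deriv γ t‖ / (1 - ‖γ t‖ ^ 2)

/-- The hyperbolic distance on `𝔻ⁿ`: the infimum of the hyperbolic lengths of the `C¹` paths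
in `𝔻ⁿ` from `x` to `y`. (Values of `γ` outside `[0,1]` play no role.) -/
noncomputable def hypDist {n : ℕ} (x y : PoincareBall n) : ℝ :=
  sInf {l : ℝ | ∃ γ : ℝ → EuclideanSpace ℝ (Fin n),
    ContDiff ℝ 1 γ ∧ γ 0 = x ∧ γ 1 = y ∧
    (∀ t ∈ Set.Icc (0 : ℝ) 1, γ t ∈ Metric.ball (0 : EuclideanSpace ℝ (Fin n)) 1) ∧
    l = hypLength γ}

/-- A bijection `g` of `𝔻ⁿ`, regarded as a map on `ℝⁿ`; the values outside `𝔻ⁿ` are irrelevant. -/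
noncomputable def ballMap {n : ℕ} (g : Equiv.Perm (PoincareBall n)) :
    EuclideanSpace ℝ (Fin n) → EuclideanSpace ℝ (Fin n) :=
  Function.extend Subtype.val (fun x : PoincareBall n => (g x : EuclideanSpace ℝ (Fin n))) id

/-- `g` belongs to `Con⁺(n)`: it is an isometry of `𝔻ⁿ` onto itself for the hyperbolic metric, and
it preserves orientation, i.e. its derivative has positive determinant at every point. -/
structure IsConPlus {n : ℕ} (g : Equiv.Perm (PoincareBall n)) : Prop where
  hypDist_eq : ∀ x y : PoincareBall n, hypDist (g x) (g y) = hypDist x y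
  det_pos : ∀ x : PoincareBall n,
    ∃ A : EuclideanSpace ℝ (Fin n) →L[ℝ] EuclideanSpace ℝ (Fin n),
      HasFDerivAt (ballMap g) A (x : EuclideanSpace ℝ (Fin n)) ∧ 0 < A.det

/-- `Γ` is a Kleinian group: a subgroup of `Con⁺(n)` which is discrete, for the topology of
uniform convergence on compact sets (the compact-open topology on `C(𝔻ⁿ, 𝔻ⁿ)`). -/
structure IsKleinian {n : ℕ} (Γ : Subgroup (Equiv.Perm (PoincareBall n))) : Prop where
  isConPlus : ∀ g ∈ Γ, IsConPlus g
  discrete : IsDiscrete {f : C(PoincareBall n, PoincareBall n) | ∃ g ∈ Γ, ⇑f = ⇑g}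

/-- The orbit `Γ(z)`, as a subset of `ℝⁿ`. -/
def ballOrbit {n : ℕ} (Γ : Subgroup (Equiv.Perm (PoincareBall n))) (z : PoincareBall n) :
    Set (EuclideanSpace ℝ (Fin n)) :=
  {x | ∃ g ∈ Γ, x = (g z : EuclideanSpace ℝ (Fin n))}

/-- The limit set `L(E)`: the Euclidean closure of `E` with `E` removed. -/
def ballLimitSet {n : ℕ} (E : Set (EuclideanSpace ℝ (Fin n))) :
    Set (EuclideanSpace ℝ (Fin n)) :=
  closure E \ E

/-- The centre of the ball. -/
def ballCentre (n : ℕ) : PoincareBall n :=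
  ⟨0, Metric.mem_ball_self one_pos⟩

/-- `Γ` is non-elementary: its limit set `L(Γ) = L(Γ(0))` has more than two points. -/
def IsNonElementary {n : ℕ} (Γ : Subgroup (Equiv.Perm (PoincareBall n))) : Prop :=
  2 < (ballLimitSet (ballOrbit Γ (ballCentre n))).encard

/-- `E` is a discrete subset of `𝔻ⁿ` which is well-approximated: up to a constant factor, every
point of `E` is as close to the limit set `L(E)` as it is to the unit sphere. -/
structure IsWellApproximated {n : ℕ} (E : Set (EuclideanSpace ℝ (Fin n))) : Prop where
  subset_ball : E ⊆ Metric.ball 0 1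
  discrete : IsDiscrete E
  exists_const : ∃ c : ℝ, 1 ≤ c ∧ ∀ x ∈ E, ∃ w ∈ ballLimitSet E, ‖x - w‖ ≤ c * (1 - ‖x‖)

/-!
Write `δ(u, v) = |u - v|² / ((1 - |u|²)(1 - |v|²))` for the point-pair invariant of the ball. The
argument needs only one fact about the hyperbolic metric: `hypDist` is a strictly increasing function
of `δ`, so a hyperbolic isometry preserves `δ` (`pairInvariant_eq_of_hypDist_eq`). To see this, a
point `x` is moved to the centre by an inversion in a sphere orthogonal to the unit sphere, which
preserves both `δ` and the line element. A path from the centre to `w` has at least the length of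
the radial segment, because its component along `w` has a smaller hyperbolic speed, and the radial
segment attains that length.

Isometries are therefore equicontinuous for the Euclidean distance, and those moving `z` a bounded
distance lie in a compact set of continuous maps, by Arzelà–Ascoli. As `Γ` is discrete, only finitely
many `g ∈ Γ` have `|g z| ≤ r < 1` (`IsKleinian.finite_setOf_norm_le`). Hence the orbit is discrete,
and its limit set consists of the points of its closure on the unit sphere; this set is the same for
all base points.

Now let `a ≠ b` be two limit points, `g ∈ Γ`, and `p = g⁻¹(0)`. One of the two, say `a`, has distance
at least `|a - b| / 3` from `p`. For points `u` of the orbit tending to `a`, the invariance of `δ`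
under `g` for the pairs `(u, p)`, `(u, z)` and `(0, z)` gives
`1 - |g u|² ≤ (1 - |u|²)(1 - |p|²) / |u - p|²`,
`|g u - g z|² = δ(u, z) (1 - |g u|²)(1 - |g z|²)`, and
`1 - |p|² = 1 - |g 0|² ≤ C (1 - |g z|²)`.
So `|g u - g z| ≤ c (1 - |g z|)` with `c` independent of `g`, while `|g u| → 1`: any accumulation
point of the points `g u` is a limit point as required
(`IsKleinian.exists_mem_ballLimitSet_norm_sub_le`). This works inside the ball and needs no extension
of `g` to the sphere.
-/

open Filter Topology

/-! ### Hyperbolic symmetries of the ball -/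

/-- The point-pair invariant `|u - v|² / ((1 - |u|²)(1 - |v|²))` of two points of the unit ball;
it equals `sinh² (d / 2)`, where `d` is the hyperbolic distance from `u` to `v`. -/
noncomputable def pairInvariant {V : Type*} [NormedAddCommGroup V] (u v : V) : ℝ :=
  ‖u - v‖ ^ 2 / ((1 - ‖u‖ ^ 2) * (1 - ‖v‖ ^ 2))

/-- `σ` restricts to a `C¹` involution of the open unit ball which preserves the point-pair
invariant and the line element `|dz| / (1 - |z|²)`. The values outside the ball are irrelevant. -/
structure IsBallSymmetry {V : Type*} [NormedAddCommGroup V] [NormedSpace ℝ V] (σ : V → V) :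
    Prop where
  norm_lt_one : ∀ u, ‖u‖ < 1 → ‖σ u‖ < 1
  involutive : ∀ u, ‖u‖ < 1 → σ (σ u) = u
  contDiffOn : ContDiffOn ℝ 1 σ (Metric.ball 0 1)
  pairInvariant_eq : ∀ u v, ‖u‖ < 1 → ‖v‖ < 1 → pairInvariant (σ u) (σ v) = pairInvariant u v
  norm_fderiv : ∀ u v, ‖u‖ < 1 → ‖fderiv ℝ σ u v‖ / (1 - ‖σ u‖ ^ 2) = ‖v‖ / (1 - ‖u‖ ^ 2)

lemma one_sub_norm_sq_pos {V : Type*} [NormedAddCommGroup V] {u : V} (hu : ‖u‖ < 1) :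
    0 < 1 - ‖u‖ ^ 2 := by
  nlinarith [norm_nonneg u]

section

variable {V : Type*} [NormedAddCommGroup V] [InnerProductSpace ℝ V]

/-- Inversion in a sphere orthogonal to the unit sphere, i.e. with `R² + 1 = |c|²`, scales
`1 - |u|²` by the same factor as lengths at `u`. -/
lemma one_sub_norm_inversion_sq {c : V} {R : ℝ} (hR : R ^ 2 + 1 = ‖c‖ ^ 2) {u : V} (hu : u ≠ c) :
    1 - ‖EuclideanGeometry.inversion c R u‖ ^ 2 = (R / dist u c) ^ 2 * (1 - ‖u‖ ^ 2) := by
  have hd : dist u c ≠ 0 := dist_ne_zero.2 hu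
  have hd2 : dist u c ^ 2 = ‖u‖ ^ 2 - 2 * inner ℝ u c + ‖c‖ ^ 2 := by
    rw [dist_eq_norm, norm_sub_sq_real]
  have hk : (R / dist u c) ^ 2 * dist u c ^ 2 = R ^ 2 := by
    rw [div_pow, div_mul_cancel₀ _ (pow_ne_zero 2 hd)]
  rw [EuclideanGeometry.inversion, vsub_eq_sub, vadd_eq_add, norm_add_sq_real, norm_smul,
    real_inner_smul_left, inner_sub_left, real_inner_self_eq_norm_sq, ← dist_eq_norm, mul_pow,
    norm_pow, Real.norm_eq_abs, sq_abs]
  generalize (R / dist u c) ^ 2 = k at *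
  have : k ^ 2 * dist u c ^ 2 = k * R ^ 2 := by rw [sq, mul_assoc, hk]
  rw [this]
  rw [hd2] at hk
  linear_combination (1 - k) * hR + hk

lemma isBallSymmetry_inversion {c : V} {R : ℝ} (hR0 : R ≠ 0) (hR : R ^ 2 + 1 = ‖c‖ ^ 2) :
    IsBallSymmetry (EuclideanGeometry.inversion c R) := by
  have hc : 1 < ‖c‖ := by
    have : 0 < R ^ 2 := by positivity
    nlinarith [norm_nonneg c]
  have hne : ∀ u : V, ‖u‖ < 1 → u ≠ c := by
    rintro u hu rfl
    linarith
  have hpos : ∀ u : V, ‖u‖ < 1 → 0 < (R / dist u c) ^ 2 := fun u hu => by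
    have := dist_pos.2 (hne u hu)
    positivity
  refine ⟨fun u hu => ?_, fun u _ => EuclideanGeometry.inversion_inversion c hR0 u, ?_,
    fun u v hu hv => ?_, fun u v hu => ?_⟩
  · have := mul_pos (hpos u hu) (one_sub_norm_sq_pos hu)
    rw [← one_sub_norm_inversion_sq hR (hne u hu)] at this
    nlinarith [norm_nonneg (EuclideanGeometry.inversion c R u)]
  · exact contDiffOn_const.inversion contDiffOn_const contDiffOn_id
      fun u hu => hne u (mem_ball_zero_iff.1 hu)
  · rw [pairInvariant, ← dist_eq_norm, EuclideanGeometry.dist_inversion_inversion (hne u hu)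
      (hne v hv), one_sub_norm_inversion_sq hR (hne u hu), one_sub_norm_inversion_sq hR (hne v hv),
      pairInvariant, ← dist_eq_norm]
    have h1 := (one_sub_norm_sq_pos hu).ne'
    have h2 := (one_sub_norm_sq_pos hv).ne'
    have h3 := dist_ne_zero.2 (hne u hu)
    have h4 := dist_ne_zero.2 (hne v hv)
    field_simp
  · rw [(EuclideanGeometry.hasFDerivAt_inversion (hne u hu)).fderiv,
      one_sub_norm_inversion_sq hR (hne u hu)]
    have h1 : ‖((R / dist u c) ^ 2 • ((ℝ ∙ (u - c))ᗮ.reflection : V →L[ℝ] V)) v‖ =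
        (R / dist u c) ^ 2 * ‖v‖ := by
      rw [smul_apply, norm_smul, norm_pow, Real.norm_eq_abs, sq_abs]
      congr 1
      exact LinearIsometryEquiv.norm_map _ v
    rw [h1, mul_div_mul_left _ _ (hpos u hu).ne']

/-- Every point `a` of the ball is carried to the centre by a symmetry: for `a ≠ 0`, by the
inversion in the sphere about `a / |a|²` orthogonal to the unit sphere. -/
lemma exists_isBallSymmetry {a : V} (ha : ‖a‖ < 1) : ∃ σ : V → V, IsBallSymmetry σ ∧ σ a = 0 := by
  rcases eq_or_ne a 0 with rfl | h0
  · exact ⟨id, ⟨fun _ h => h, fun _ _ => rfl, contDiffOn_id, fun _ _ _ _ => rfl,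
      fun u v _ => by simp⟩, rfl⟩
  have hn : 0 < ‖a‖ := norm_pos_iff.2 h0
  have hlt : 0 < (‖a‖ ^ 2)⁻¹ - 1 := by
    have : 1 < (‖a‖ ^ 2)⁻¹ := (one_lt_inv₀ (by positivity)).2 (by nlinarith)
    linarith
  have hcn : ‖(‖a‖ ^ 2)⁻¹ • a‖ ^ 2 = (‖a‖ ^ 2)⁻¹ := by
    rw [norm_smul, norm_inv, norm_pow, norm_norm]
    field_simp
  have hR : √((‖a‖ ^ 2)⁻¹ - 1) ^ 2 = (‖a‖ ^ 2)⁻¹ - 1 := Real.sq_sqrt hlt.le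
  refine ⟨EuclideanGeometry.inversion ((‖a‖ ^ 2)⁻¹ • a) (√((‖a‖ ^ 2)⁻¹ - 1)),
    isBallSymmetry_inversion (Real.sqrt_pos.2 hlt).ne' (by rw [hR, hcn]; ring), ?_⟩
  have hac : a - (‖a‖ ^ 2)⁻¹ • a = (-((‖a‖ ^ 2)⁻¹ - 1)) • a := by
    rw [neg_smul, sub_smul, one_smul, neg_sub]
  rw [EuclideanGeometry.inversion, vsub_eq_sub, vadd_eq_add, div_pow, hR, dist_eq_norm, hac,
    norm_smul, smul_smul, ← add_smul, norm_neg, Real.norm_of_nonneg hlt.le]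
  convert zero_smul ℝ a using 2
  have h1 := (one_sub_norm_sq_pos ha).ne'
  field_simp
  ring

end

/-! ### The hyperbolic distance -/

/-- The hyperbolic distance from the centre of the ball to a point at Euclidean distance `r`. -/
noncomputable def radialLength (r : ℝ) : ℝ :=
  Real.log (1 + r) - Real.log (1 - r)

lemma hasDerivAt_radialLength {s : ℝ} (hs : |s| < 1) :
    HasDerivAt radialLength (2 / (1 - s ^ 2)) s := by
  obtain ⟨h1, h2⟩ := abs_lt.1 hs
  have h3 : 1 + s ≠ 0 := by linarith
  have h4 : 1 - s ≠ 0 := by linarith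
  have h5 : 1 - s ^ 2 ≠ 0 := by
    rw [show 1 - s ^ 2 = (1 + s) * (1 - s) by ring]
    exact mul_ne_zero h3 h4
  refine ((((hasDerivAt_id s).const_add 1).log h3).sub
    (((hasDerivAt_id s).const_sub 1).log h4)).congr_deriv ?_
  simp only [id]
  field_simp
  ring

lemma radialLength_zero : radialLength 0 = 0 := by simp [radialLength]

lemma strictMonoOn_radialLength : StrictMonoOn radialLength (Set.Ico 0 1) := by
  rintro r ⟨hr0, hr1⟩ s ⟨hs0, hs1⟩ hrs
  exact sub_lt_sub (Real.log_lt_log (by linarith) (by linarith))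
    (Real.log_lt_log (by linarith) (by linarith))

lemma continuousOn_hypLength_integrand {n : ℕ} {γ : ℝ → EuclideanSpace ℝ (Fin n)}
    (hγ : ContDiff ℝ 1 γ) (hball : ∀ t ∈ Set.Icc (0 : ℝ) 1, ‖γ t‖ < 1) :
    ContinuousOn (fun t => 2 * ‖deriv γ t‖ / (1 - ‖γ t‖ ^ 2)) (Set.Icc 0 1) := by
  refine ContinuousOn.div ?_ ?_ fun t ht => (one_sub_norm_sq_pos (hball t ht)).ne'
  · exact (continuous_const.mul (hγ.continuous_deriv le_rfl).norm).continuousOn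
  · exact (continuous_const.sub (hγ.continuous.norm.pow 2)).continuousOn

lemma IsBallSymmetry.differentiableAt {V : Type*} [NormedAddCommGroup V] [NormedSpace ℝ V]
    {σ : V → V} (hσ : IsBallSymmetry σ) {u : V} (hu : ‖u‖ < 1) : DifferentiableAt ℝ σ u :=
  (hσ.contDiffOn.contDiffAt (Metric.isOpen_ball.mem_nhds (mem_ball_zero_iff.2 hu))).differentiableAt
    one_ne_zero

/-- A path is at least as long as the radial segment reached after moving its starting point to
the centre: the component of the moved path in the direction of its end point has a hyperbolic
speed at most that of the path. -/
lemma radialLength_le_hypLength {n : ℕ} {γ : ℝ → EuclideanSpace ℝ (Fin n)}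
    {σ : EuclideanSpace ℝ (Fin n) → EuclideanSpace ℝ (Fin n)} (hσ : IsBallSymmetry σ)
    (hγ : ContDiff ℝ 1 γ) (hball : ∀ t ∈ Set.Icc (0 : ℝ) 1, ‖γ t‖ < 1) (h0 : σ (γ 0) = 0) :
    radialLength ‖σ (γ 1)‖ ≤ hypLength γ := by
  set w := σ (γ 1) with hw
  set e := ‖w‖⁻¹ • w with he
  have he1 : ‖e‖ ≤ 1 := by
    rw [he, norm_smul, norm_inv, norm_norm]
    exact inv_mul_le_one
  have hew : inner ℝ e w = ‖w‖ := by
    rw [he, real_inner_smul_left, real_inner_self_eq_norm_sq]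
    rcases eq_or_ne ‖w‖ 0 with h | h
    · simp [h]
    · field_simp
  have hs : ∀ u : EuclideanSpace ℝ (Fin n), |inner ℝ e u| ≤ ‖u‖ := fun u =>
    (abs_real_inner_le_norm e u).trans (mul_le_of_le_one_left (norm_nonneg u) he1)
  have hs1 : ∀ t ∈ Set.Icc (0 : ℝ) 1, |inner ℝ e (σ (γ t))| < 1 := fun t ht =>
    (hs _).trans_lt (hσ.norm_lt_one _ (hball t ht))
  have hderiv : ∀ t ∈ Set.Icc (0 : ℝ) 1, HasDerivAt (fun t => radialLength (inner ℝ e (σ (γ t))))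
      (2 / (1 - inner ℝ e (σ (γ t)) ^ 2) * inner ℝ e (fderiv ℝ σ (γ t) (deriv γ t))) t := by
    intro t ht
    have h1 : HasDerivAt (fun t => σ (γ t)) (fderiv ℝ σ (γ t) (deriv γ t)) t :=
      (hσ.differentiableAt (hball t ht)).hasFDerivAt.comp_hasDerivAt t
        (hγ.differentiable one_ne_zero t).hasDerivAt
    have h2 : HasDerivAt (fun t => inner ℝ e (σ (γ t)))
        (inner ℝ e (fderiv ℝ σ (γ t) (deriv γ t))) t := by
      simpa using (hasDerivAt_const t e).inner ℝ h1
    exact (hasDerivAt_radialLength (hs1 t ht)).comp t h2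
  have key := intervalIntegral.sub_le_integral_of_hasDeriv_right_of_le (zero_le_one' ℝ)
    (fun t ht => (hderiv t ht).continuousAt.continuousWithinAt)
    (fun t ht => (hderiv t (Set.Ioo_subset_Icc_self ht)).hasDerivWithinAt)
    ((continuousOn_hypLength_integrand hγ hball).integrableOn_Icc) ?_
  · rw [h0, ← hw, hew, inner_zero_right, radialLength_zero, sub_zero] at key
    exact key
  · intro t ht
    have ht' := Set.Ioo_subset_Icc_self ht
    have h1 := one_sub_norm_sq_pos (hσ.norm_lt_one _ (hball t ht'))
    have h2 : inner ℝ e (σ (γ t)) ^ 2 ≤ ‖σ (γ t)‖ ^ 2 := by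
      rw [← sq_abs]
      gcongr
      exact hs _
    calc 2 / (1 - inner ℝ e (σ (γ t)) ^ 2) * inner ℝ e (fderiv ℝ σ (γ t) (deriv γ t))
        ≤ 2 / (1 - ‖σ (γ t)‖ ^ 2) * ‖fderiv ℝ σ (γ t) (deriv γ t)‖ := by
          refine mul_le_mul_of_nonneg ?_ ((le_abs_self _).trans (hs _)) ?_ (norm_nonneg _)
          · gcongr
          · exact div_nonneg zero_le_two (by linarith)
      _ = 2 * (‖deriv γ t‖ / (1 - ‖γ t‖ ^ 2)) := by
          rw [← hσ.norm_fderiv _ _ (hball t ht')]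
          ring
      _ = 2 * ‖deriv γ t‖ / (1 - ‖γ t‖ ^ 2) := by ring

/-- The image under a symmetry of a radial segment, parametrised smoothly and
monotonically on `[0, 1]` so that it stays in the ball for all times, has the expected length. -/
lemma exists_hypLength_eq_radialLength {n : ℕ}
    {σ : EuclideanSpace ℝ (Fin n) → EuclideanSpace ℝ (Fin n)} (hσ : IsBallSymmetry σ)
    {w : EuclideanSpace ℝ (Fin n)} (hw : ‖w‖ < 1) :
    ∃ γ : ℝ → EuclideanSpace ℝ (Fin n), ContDiff ℝ 1 γ ∧ γ 0 = σ 0 ∧ γ 1 = σ w ∧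
      (∀ t, ‖γ t‖ < 1) ∧ hypLength γ = radialLength ‖w‖ := by
  set φ : ℝ → ℝ := fun t => (1 - Real.cos (Real.pi * t)) / 2 with hφ
  have hφd : ∀ t, HasDerivAt φ (Real.pi * Real.sin (Real.pi * t) / 2) t := fun t => by
    refine ((((Real.hasDerivAt_cos (Real.pi * t)).comp t
      ((hasDerivAt_id t).const_mul Real.pi)).const_sub 1).div_const 2).congr_deriv ?_
    ring
  have hφc : ContDiff ℝ 1 φ := by fun_prop
  have hφ0 : ∀ t, 0 ≤ φ t := fun t => by
    have := Real.cos_le_one (Real.pi * t)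
    simp only [hφ]
    linarith
  have hφ1 : ∀ t, φ t ≤ 1 := fun t => by
    have := Real.neg_one_le_cos (Real.pi * t)
    simp only [hφ]
    linarith
  have hn : ∀ t, ‖φ t • w‖ = φ t * ‖w‖ := fun t => by
    rw [norm_smul, Real.norm_of_nonneg (hφ0 t)]
  have hb : ∀ t, ‖φ t • w‖ < 1 := fun t => by
    rw [hn]
    nlinarith [hφ1 t, hφ0 t, norm_nonneg w]
  have hγc : ContDiff ℝ 1 fun t => σ (φ t • w) := by
    rw [← contDiffOn_univ]
    exact hσ.contDiffOn.comp (hφc.smul contDiff_const).contDiffOn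
      fun t _ => mem_ball_zero_iff.2 (hb t)
  have hball : ∀ t, ‖σ (φ t • w)‖ < 1 := fun t => hσ.norm_lt_one _ (hb t)
  refine ⟨fun t => σ (φ t • w), hγc, by simp [hφ], by simp [hφ], hball, ?_⟩
  have hderiv : ∀ t ∈ Set.uIcc (0 : ℝ) 1, HasDerivAt (fun t => radialLength (φ t * ‖w‖))
      (2 * ‖deriv (fun t => σ (φ t • w)) t‖ / (1 - ‖σ (φ t • w)‖ ^ 2)) t := by
    intro t ht
    rw [Set.uIcc_of_le zero_le_one] at ht
    have hsin : 0 ≤ Real.pi * Real.sin (Real.pi * t) / 2 := by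
      have := Real.sin_nonneg_of_nonneg_of_le_pi (mul_nonneg Real.pi_pos.le ht.1)
        (mul_le_of_le_one_right Real.pi_pos.le ht.2)
      positivity
    have h1 : HasDerivAt (fun t => σ (φ t • w))
        (fderiv ℝ σ (φ t • w) ((Real.pi * Real.sin (Real.pi * t) / 2) • w)) t :=
      (hσ.differentiableAt (hb t)).hasFDerivAt.comp_hasDerivAt t ((hφd t).smul_const w)
    have h2 : |φ t * ‖w‖| < 1 := by
      rw [← hn, abs_norm]
      exact hb t
    have h3 := (hasDerivAt_radialLength h2).comp t ((hφd t).mul_const ‖w‖)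
    have h4 := hσ.norm_fderiv (φ t • w) ((Real.pi * Real.sin (Real.pi * t) / 2) • w) (hb t)
    rw [h1.deriv, mul_div_assoc, h4, norm_smul, Real.norm_of_nonneg hsin, hn]
    exact h3.congr_deriv (by ring)
  rw [hypLength, intervalIntegral.integral_eq_sub_of_hasDerivAt hderiv]
  · simp [hφ, radialLength_zero]
  · refine ContinuousOn.intervalIntegrable ?_
    rw [Set.uIcc_of_le zero_le_one]
    exact continuousOn_hypLength_integrand hγc fun t _ => hball t

lemma hypDist_eq_radialLength {n : ℕ} (x y : PoincareBall n)
    {σ : EuclideanSpace ℝ (Fin n) → EuclideanSpace ℝ (Fin n)} (hσ : IsBallSymmetry σ)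
    (hx : σ x = 0) : hypDist x y = radialLength ‖σ y‖ := by
  have hx1 : ‖(x : EuclideanSpace ℝ (Fin n))‖ < 1 := mem_ball_zero_iff.1 x.2
  have hy1 : ‖(y : EuclideanSpace ℝ (Fin n))‖ < 1 := mem_ball_zero_iff.1 y.2
  refine IsLeast.csInf_eq ⟨?_, ?_⟩
  · obtain ⟨γ, hγ, h0, h1, hb, hl⟩ := exists_hypLength_eq_radialLength hσ (hσ.norm_lt_one y hy1)
    refine ⟨γ, hγ, ?_, ?_, fun t _ => mem_ball_zero_iff.2 (hb t), hl.symm⟩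
    · simpa [h0, hx] using hσ.involutive _ hx1
    · rw [h1, hσ.involutive _ hy1]
  · rintro l ⟨γ, hγ, h0, h1, hb, rfl⟩
    rw [← h1]
    exact radialLength_le_hypLength hσ hγ (fun t ht => mem_ball_zero_iff.1 (hb t ht))
      (by rw [h0, hx])

/-- The hyperbolic distance determines the point-pair invariant. -/
lemma pairInvariant_eq_of_hypDist_eq {n : ℕ} {x y x' y' : PoincareBall n}
    (h : hypDist x y = hypDist x' y') :
    pairInvariant (x : EuclideanSpace ℝ (Fin n)) y =
      pairInvariant (x' : EuclideanSpace ℝ (Fin n)) y' := by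
  have hb : ∀ x : PoincareBall n, ‖(x : EuclideanSpace ℝ (Fin n))‖ < 1 :=
    fun x => mem_ball_zero_iff.1 x.2
  obtain ⟨σ, hσ, hx⟩ := exists_isBallSymmetry (hb x)
  obtain ⟨τ, hτ, hx'⟩ := exists_isBallSymmetry (hb x')
  rw [hypDist_eq_radialLength x y hσ hx, hypDist_eq_radialLength x' y' hτ hx'] at h
  have hr := strictMonoOn_radialLength.injOn ⟨norm_nonneg _, hσ.norm_lt_one _ (hb y)⟩
    ⟨norm_nonneg _, hτ.norm_lt_one _ (hb y')⟩ h
  rw [← hσ.pairInvariant_eq _ _ (hb x) (hb y), ← hτ.pairInvariant_eq _ _ (hb x') (hb y'), hx, hx']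
  simp [pairInvariant, hr]

/-! ### Maps preserving the point-pair invariant -/

section

variable {V : Type*} [NormedAddCommGroup V]

lemma pairInvariant_comm (u v : V) : pairInvariant u v = pairInvariant v u := by
  rw [pairInvariant, pairInvariant, norm_sub_rev, mul_comm (1 - ‖u‖ ^ 2)]

lemma norm_sub_sq_eq_pairInvariant_mul {u v : V} (hu : ‖u‖ < 1) (hv : ‖v‖ < 1) :
    ‖u - v‖ ^ 2 = pairInvariant u v * ((1 - ‖u‖ ^ 2) * (1 - ‖v‖ ^ 2)) :=
  (div_mul_cancel₀ _ (mul_pos (one_sub_norm_sq_pos hu) (one_sub_norm_sq_pos hv)).ne').symm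

lemma pairInvariant_nonneg {u v : V} (hu : ‖u‖ < 1) (hv : ‖v‖ < 1) : 0 ≤ pairInvariant u v :=
  div_nonneg (sq_nonneg _) (mul_pos (one_sub_norm_sq_pos hu) (one_sub_norm_sq_pos hv)).le

/-- Points at a bounded hyperbolic distance have comparable distances to the unit sphere. -/
lemma one_sub_norm_sq_le_mul {u v : V} (hu : ‖u‖ < 1) (hv : ‖v‖ < 1) :
    1 - ‖u‖ ^ 2 ≤ (2 + 4 * pairInvariant u v) * (1 - ‖v‖ ^ 2) := by
  have hA := one_sub_norm_sq_pos hu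
  have hB := one_sub_norm_sq_pos hv
  have h := norm_sub_sq_eq_pairInvariant_mul hu hv
  have hD := pairInvariant_nonneg hu hv
  have htri : ‖v‖ ≤ ‖u‖ + ‖u - v‖ := by
    rw [norm_sub_rev]
    linarith [norm_sub_norm_le v u]
  have h1 : (1 - ‖u‖ ^ 2) - (1 - ‖v‖ ^ 2) ≤ 2 * ‖u - v‖ := by
    nlinarith [norm_nonneg u, norm_nonneg v, norm_nonneg (u - v)]
  generalize 1 - ‖u‖ ^ 2 = A at *
  generalize 1 - ‖v‖ ^ 2 = B at *
  generalize pairInvariant u v = D at *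
  by_contra! hlt
  -- The square of `A - B` is at most `4 D A B`, and `A` is larger than both `2 B` and `4 D B`.
  have h2 : (A - B) ^ 2 ≤ 4 * (D * (A * B)) := by
    rw [← h]
    have hAB : 0 ≤ A - B := by nlinarith [mul_nonneg hD hB.le]
    nlinarith
  nlinarith [mul_pos hA hB, mul_nonneg hD hB.le]

end

lemma PoincareBall.norm_lt_one {n : ℕ} (x : PoincareBall n) :
    ‖(x : EuclideanSpace ℝ (Fin n))‖ < 1 :=
  mem_ball_zero_iff.1 x.2

/-- The self-map `f` of the ball preserves the point-pair invariant. -/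
def PreservesPairInvariant {n : ℕ} (f : PoincareBall n → PoincareBall n) : Prop :=
  ∀ u v, pairInvariant (f u : EuclideanSpace ℝ (Fin n)) (f v) =
    pairInvariant (u : EuclideanSpace ℝ (Fin n)) v

lemma IsConPlus.preservesPairInvariant {n : ℕ} {g : Equiv.Perm (PoincareBall n)}
    (hg : IsConPlus g) : PreservesPairInvariant g :=
  fun u v => pairInvariant_eq_of_hypDist_eq (hg.hypDist_eq u v)

/-- An isometry does not increase `1 - |u|²` by more than a bounded factor, except near the
preimage `p` of the centre. -/
lemma PreservesPairInvariant.one_sub_norm_sq_mul_le {n : ℕ} {f : PoincareBall n → PoincareBall n}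
    (hf : PreservesPairInvariant f) {p : PoincareBall n} (hp : f p = ballCentre n)
    (u : PoincareBall n) :
    (1 - ‖(f u : EuclideanSpace ℝ (Fin n))‖ ^ 2) * ‖(u : EuclideanSpace ℝ (Fin n)) - p‖ ^ 2 ≤
      (1 - ‖(u : EuclideanSpace ℝ (Fin n))‖ ^ 2) * (1 - ‖(p : EuclideanSpace ℝ (Fin n))‖ ^ 2) := by
  have h1 := norm_sub_sq_eq_pairInvariant_mul u.norm_lt_one p.norm_lt_one
  have h2 := norm_sub_sq_eq_pairInvariant_mul (f u).norm_lt_one (f p).norm_lt_one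
  rw [hf u p, hp] at h2
  simp only [ballCentre, sub_zero, norm_zero] at h2
  rw [zero_pow two_ne_zero, sub_zero, mul_one] at h2
  have hu := one_sub_norm_sq_pos u.norm_lt_one
  have hp := one_sub_norm_sq_pos p.norm_lt_one
  have hfu := one_sub_norm_sq_pos (f u).norm_lt_one
  have h3 : (1 - ‖(f u : EuclideanSpace ℝ (Fin n))‖ ^ 2) *
      ‖(u : EuclideanSpace ℝ (Fin n)) - p‖ ^ 2 =
      ‖(f u : EuclideanSpace ℝ (Fin n))‖ ^ 2 * ((1 - ‖(u : EuclideanSpace ℝ (Fin n))‖ ^ 2) *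
      (1 - ‖(p : EuclideanSpace ℝ (Fin n))‖ ^ 2)) := by
    linear_combination (1 - ‖(f u : EuclideanSpace ℝ (Fin n))‖ ^ 2) * h1 -
      (1 - ‖(u : EuclideanSpace ℝ (Fin n))‖ ^ 2) *
        (1 - ‖(p : EuclideanSpace ℝ (Fin n))‖ ^ 2) * h2
  rw [h3]
  exact mul_le_of_le_one_left (mul_pos hu hp).le (by linarith)

lemma PreservesPairInvariant.norm_preimage_centre {n : ℕ} {f : PoincareBall n → PoincareBall n}
    (hf : PreservesPairInvariant f) {p : PoincareBall n} (hp : f p = ballCentre n) :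
    1 - ‖(p : EuclideanSpace ℝ (Fin n))‖ ^ 2 =
      1 - ‖(f (ballCentre n) : EuclideanSpace ℝ (Fin n))‖ ^ 2 := by
  have h := hf (ballCentre n) p
  have h1 := one_sub_norm_sq_pos p.norm_lt_one
  have h2 := one_sub_norm_sq_pos (f (ballCentre n)).norm_lt_one
  rw [hp, pairInvariant, pairInvariant] at h
  simp only [ballCentre, sub_zero, norm_zero, zero_sub, norm_neg] at h h2 ⊢
  rw [div_eq_div_iff (by positivity) (by positivity)] at h
  linarith

/-! ### Proper discontinuity -/

/-- The point-pair invariant is a common modulus of continuity for the Euclidean distance: it tends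
to zero as its arguments merge. -/
lemma equicontinuous_of_norm_sub_sq_le {n : ℕ} {ι : Type*}
    (F : ι → PoincareBall n → PoincareBall n)
    (hF : ∀ i u v, ‖(F i u : EuclideanSpace ℝ (Fin n)) - F i v‖ ^ 2 ≤
      pairInvariant (u : EuclideanSpace ℝ (Fin n)) v) : Equicontinuous F := by
  intro u
  refine Metric.equicontinuousAt_of_continuity_modulus
    (fun v : PoincareBall n => √(pairInvariant (u : EuclideanSpace ℝ (Fin n)) v)) ?_ _
    (Eventually.of_forall fun v i => ?_)
  · have hc : ContinuousAt
        (fun v : PoincareBall n => √(pairInvariant (u : EuclideanSpace ℝ (Fin n)) v)) u := by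
      unfold pairInvariant
      refine (ContinuousAt.div (by fun_prop) (by fun_prop) ?_).sqrt
      exact (mul_pos (one_sub_norm_sq_pos u.norm_lt_one) (one_sub_norm_sq_pos u.norm_lt_one)).ne'
    simpa [ContinuousAt, pairInvariant] using hc
  · rw [Subtype.dist_eq, dist_eq_norm]
    exact Real.le_sqrt_of_sq_le (hF i u v)

lemma PreservesPairInvariant.norm_sub_sq_le {n : ℕ} {f : PoincareBall n → PoincareBall n}
    (hf : PreservesPairInvariant f) (u v : PoincareBall n) :
    ‖(f u : EuclideanSpace ℝ (Fin n)) - f v‖ ^ 2 ≤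
      pairInvariant (u : EuclideanSpace ℝ (Fin n)) v := by
  rw [norm_sub_sq_eq_pairInvariant_mul (f u).norm_lt_one (f v).norm_lt_one, hf u v]
  refine mul_le_of_le_one_right (pairInvariant_nonneg u.norm_lt_one v.norm_lt_one) ?_
  have h1 := one_sub_norm_sq_pos (f v).norm_lt_one
  exact mul_le_one₀ (sub_le_self _ (sq_nonneg _)) h1.le
    (sub_le_self _ (sq_nonneg _))

lemma PreservesPairInvariant.continuous {n : ℕ} {f : PoincareBall n → PoincareBall n}
    (hf : PreservesPairInvariant f) : Continuous f :=
  (equicontinuous_of_norm_sub_sq_le (fun _ : Unit => f)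
    fun _ => hf.norm_sub_sq_le).continuous ()

/-- A set of continuous self-maps of the ball containing every isometry `f` with
`κ ≤ 1 - |f z|²`; its two conditions are closed for pointwise convergence. -/
def boundedMaps {n : ℕ} (z : PoincareBall n) (κ : ℝ) : Set C(PoincareBall n, PoincareBall n) :=
  {f | (∀ u v : PoincareBall n, ‖(f u : EuclideanSpace ℝ (Fin n)) - f v‖ ^ 2 ≤
      pairInvariant (u : EuclideanSpace ℝ (Fin n)) v) ∧
    ∀ u : PoincareBall n, κ ≤ (2 + 4 * pairInvariant (z : EuclideanSpace ℝ (Fin n)) u) *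
      (1 - ‖(f u : EuclideanSpace ℝ (Fin n))‖ ^ 2)}

lemma PreservesPairInvariant.mem_boundedMaps {n : ℕ} {f : C(PoincareBall n, PoincareBall n)}
    (hf : PreservesPairInvariant f) {z : PoincareBall n} {κ : ℝ}
    (h : κ ≤ 1 - ‖(f z : EuclideanSpace ℝ (Fin n))‖ ^ 2) : f ∈ boundedMaps z κ := by
  refine ⟨hf.norm_sub_sq_le, fun u => h.trans ?_⟩
  rw [← hf z u]
  exact one_sub_norm_sq_le_mul (f z).norm_lt_one (f u).norm_lt_one

lemma isCompact_setOf_le_mul_one_sub_norm_sq {n : ℕ} {κ C : ℝ} (hκ : 0 < κ) (hC : 0 < C) :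
    IsCompact {y : PoincareBall n | κ ≤ C * (1 - ‖(y : EuclideanSpace ℝ (Fin n))‖ ^ 2)} := by
  rw [Subtype.isCompact_iff]
  have himg : ((↑) : PoincareBall n → EuclideanSpace ℝ (Fin n)) ''
      {y : PoincareBall n | κ ≤ C * (1 - ‖(y : EuclideanSpace ℝ (Fin n))‖ ^ 2)} =
      {y | κ ≤ C * (1 - ‖y‖ ^ 2)} := by
    ext y
    refine ⟨?_, fun hy => ?_⟩
    · rintro ⟨y, hy, rfl⟩
      exact hy
    · have h1 : 0 < 1 - ‖y‖ ^ 2 := pos_of_mul_pos_right (hκ.trans_le hy) hC.le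
      exact ⟨⟨y, mem_ball_zero_iff.2 (by nlinarith [norm_nonneg y])⟩, hy, rfl⟩
  rw [himg]
  refine (isCompact_closedBall (0 : EuclideanSpace ℝ (Fin n)) 1).of_isClosed_subset
    (isClosed_le (by fun_prop) (by fun_prop)) fun y hy => ?_
  have h1 : 0 < 1 - ‖y‖ ^ 2 := pos_of_mul_pos_right (hκ.trans_le hy) hC.le
  rw [mem_closedBall_zero_iff]
  nlinarith [norm_nonneg y]

lemma isCompact_boundedMaps {n : ℕ} (z : PoincareBall n) {κ : ℝ} (hκ : 0 < κ) :
    IsCompact (boundedMaps z κ) := by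
  refine ArzelaAscoli.isCompact_of_equicontinuous _ ?_
    (equicontinuous_of_norm_sub_sq_le _ fun f => f.2.1)
  have himg : ContinuousMap.toFun '' boundedMaps z κ =
      Set.univ.pi (fun u : PoincareBall n => {y : PoincareBall n |
        κ ≤ (2 + 4 * pairInvariant (z : EuclideanSpace ℝ (Fin n)) u) *
          (1 - ‖(y : EuclideanSpace ℝ (Fin n))‖ ^ 2)}) ∩
      {f : PoincareBall n → PoincareBall n |
        ∀ u v : PoincareBall n, ‖(f u : EuclideanSpace ℝ (Fin n)) - f v‖ ^ 2 ≤
          pairInvariant (u : EuclideanSpace ℝ (Fin n)) v} := by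
    ext f
    refine ⟨?_, fun ⟨h1, h2⟩ => ?_⟩
    · rintro ⟨f, ⟨h1, h2⟩, rfl⟩
      exact ⟨fun u _ => h2 u, h1⟩
    · have hc : Continuous f :=
        (equicontinuous_of_norm_sub_sq_le (fun _ : Unit => f) fun _ => h2).continuous ()
      exact ⟨⟨f, hc⟩, ⟨h2, fun u => h1 u (Set.mem_univ u)⟩, rfl⟩
  rw [himg]
  refine (isCompact_univ_pi fun u => isCompact_setOf_le_mul_one_sub_norm_sq hκ ?_).inter_right ?_
  · linarith [pairInvariant_nonneg z.norm_lt_one u.norm_lt_one]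
  · simp only [Set.ofPred_forall]
    exact isClosed_iInter fun u => isClosed_iInter fun v =>
      isClosed_le (by fun_prop) continuous_const

/-- An infinite family of group elements moving `z` a bounded distance would, together with the
inverses, accumulate in the space of pairs of continuous maps. Quotients of two members close to
the accumulation point are then close to the identity, against discreteness. -/
lemma IsKleinian.finite_setOf_norm_le {n : ℕ} {Γ : Subgroup (Equiv.Perm (PoincareBall n))}
    (hΓ : IsKleinian Γ) (z : PoincareBall n) {r : ℝ} (hr : r < 1) :
    {g | g ∈ Γ ∧ ‖(g z : EuclideanSpace ℝ (Fin n))‖ ≤ r}.Finite := by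
  set T := {g | g ∈ Γ ∧ ‖(g z : EuclideanSpace ℝ (Fin n))‖ ≤ r} with hT
  by_contra hinf
  obtain ⟨g₀, hg₀⟩ : T.Nonempty := Set.Infinite.nonempty hinf
  have hr0 : 0 ≤ r := (norm_nonneg _).trans hg₀.2
  have hpres : ∀ g ∈ Γ, PreservesPairInvariant g :=
    fun g hg => (hΓ.isConPlus g hg).preservesPairInvariant
  have : LocallyCompactSpace (PoincareBall n) := Metric.isOpen_ball.locallyCompactSpace
  have hex : ∀ g : Equiv.Perm (PoincareBall n), ∃ f : C(PoincareBall n, PoincareBall n),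
      g ∈ Γ → ⇑f = ⇑g := fun g => by
    by_cases hg : g ∈ Γ
    · exact ⟨⟨g, (hpres g hg).continuous⟩, fun _ => rfl⟩
    · exact ⟨ContinuousMap.id _, fun h => absurd h hg⟩
  choose F hF using hex
  have hz := one_sub_norm_sq_pos z.norm_lt_one
  have hκ : 0 < 1 - r ^ 2 := by nlinarith
  -- `M` bounds the point-pair invariant of `z` and `g⁻¹ z` for `g ∈ T`.
  set M := 4 / ((1 - r ^ 2) * (1 - ‖(z : EuclideanSpace ℝ (Fin n))‖ ^ 2)) with hM
  have hM0 : 0 < 2 + 4 * M := by positivity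
  have hnorm : ∀ g ∈ T, 1 - r ^ 2 ≤ 1 - ‖(g z : EuclideanSpace ℝ (Fin n))‖ ^ 2 := fun g hg => by
    have := hg.2
    gcongr
  have hmem : ∀ g ∈ T, F g ∈ boundedMaps z (1 - r ^ 2) := fun g hg => by
    refine PreservesPairInvariant.mem_boundedMaps ?_ ?_
    · rw [hF g hg.1]
      exact hpres g hg.1
    · rw [hF g hg.1]
      exact hnorm g hg
  have hmem' : ∀ g ∈ T, F g⁻¹ ∈
      boundedMaps z ((1 - ‖(z : EuclideanSpace ℝ (Fin n))‖ ^ 2) / (2 + 4 * M)) := fun g hg => by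
    have hgi := Γ.inv_mem hg.1
    refine PreservesPairInvariant.mem_boundedMaps ?_ ?_
    · rw [hF _ hgi]
      exact hpres _ hgi
    · rw [hF _ hgi, div_le_iff₀' hM0]
      refine (one_sub_norm_sq_le_mul z.norm_lt_one (g⁻¹ z).norm_lt_one).trans ?_
      have hpos := one_sub_norm_sq_pos (g⁻¹ z).norm_lt_one
      have hpi : pairInvariant (z : EuclideanSpace ℝ (Fin n)) (g⁻¹ z) ≤ M := by
        rw [← hpres g hg.1, show g (g⁻¹ z) = z from g.apply_symm_apply z, pairInvariant]
        have h2 : ‖(g z : EuclideanSpace ℝ (Fin n)) - z‖ ≤ 2 :=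
          (norm_sub_le _ _).trans (by linarith [(g z).norm_lt_one, z.norm_lt_one])
        have h4 : ‖(g z : EuclideanSpace ℝ (Fin n)) - z‖ ^ 2 ≤ 4 := by
          nlinarith [norm_nonneg ((g z : EuclideanSpace ℝ (Fin n)) - z)]
        have := hnorm g hg
        rw [hM]
        gcongr
      gcongr
  have hinj : Set.InjOn (fun g => (F g, F g⁻¹)) T := fun g hg h hh heq => by
    have h1 : F g = F h := congrArg Prod.fst heq
    exact DFunLike.coe_injective (by rw [← hF g hg.1, ← hF h hh.1, h1])
  have hcomp : ∀ g ∈ Γ, ∀ h ∈ Γ, ⇑((F g⁻¹).comp (F h)) = ⇑(g⁻¹ * h) := fun g hg h hh => by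
    rw [ContinuousMap.coe_comp, hF _ (Γ.inv_mem hg), hF _ hh]
    rfl
  obtain ⟨⟨f₁, f₂⟩, -, hacc⟩ := (Set.Infinite.image hinj hinf).exists_accPt_of_subset_isCompact
    ((isCompact_boundedMaps z hκ).prod (isCompact_boundedMaps z (div_pos hz hM0)))
    (by
      rintro _ ⟨g, hg, rfl⟩
      exact ⟨hmem g hg, hmem' g hg⟩)
  have hcont : Continuous fun p : C(PoincareBall n, PoincareBall n) ×
      C(PoincareBall n, PoincareBall n) => p.2.comp p.1 := ContinuousMap.continuous_comp'
  rw [accPt_iff_nhds] at hacc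
  have hid : f₂.comp f₁ = ContinuousMap.id _ := by
    have hclosed := (isClosed_singleton (x := ContinuousMap.id (PoincareBall n))).preimage hcont
    refine closure_minimal (s := (fun g => (F g, F g⁻¹)) '' T) ?_ hclosed
      (?_ : (f₁, f₂) ∈ closure _)
    · rintro _ ⟨g, hg, rfl⟩
      refine DFunLike.coe_injective ?_
      rw [hcomp g hg.1 g hg.1, inv_mul_cancel]
      rfl
    · rw [mem_closure_iff_nhds]
      exact fun U hU => let ⟨y, hy, _⟩ := hacc U hU; ⟨y, hy⟩
  have hone : ContinuousMap.id (PoincareBall n) ∈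
      {f : C(PoincareBall n, PoincareBall n) | ∃ g ∈ Γ, ⇑f = ⇑g} := ⟨1, Γ.one_mem, rfl⟩
  have hdisc := isDiscrete_iff_nhdsWithin.1 hΓ.discrete _ hone
  obtain ⟨U, hU, hUs⟩ := mem_nhdsWithin_iff_exists_mem_nhds_inter.1
    (le_pure_iff.1 hdisc.le)
  have hpair : Tendsto (fun q : (C(PoincareBall n, PoincareBall n) ×
      C(PoincareBall n, PoincareBall n)) × (C(PoincareBall n, PoincareBall n) ×
      C(PoincareBall n, PoincareBall n)) => q.1.2.comp q.2.1) (𝓝 (f₁, f₂) ×ˢ 𝓝 (f₁, f₂))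
      (𝓝 (ContinuousMap.id _)) := by
    rw [← nhds_prod_eq, ← hid]
    exact (hcont.comp (continuous_snd.fst.prodMk continuous_fst.snd)).tendsto
      ((f₁, f₂), (f₁, f₂))
  obtain ⟨W, hW, hWU⟩ := mem_prod_same_iff.1 (hpair hU)
  -- Two distinct members close to the accumulation point.
  obtain ⟨_, ⟨hyW, g, hg, rfl⟩, hyne⟩ := hacc W hW
  obtain ⟨_, ⟨⟨hxW, hxy⟩, h, hh, rfl⟩, -⟩ :=
    hacc (W ∩ {(F g, F g⁻¹)}ᶜ) (inter_mem hW (isOpen_compl_singleton.mem_nhds hyne.symm))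
  have hgh : (F g⁻¹).comp (F h) = ContinuousMap.id _ :=
    hUs ⟨hWU (Set.mk_mem_prod hyW hxW), g⁻¹ * h, Γ.mul_mem (Γ.inv_mem hg.1) hh.1,
      hcomp g hg.1 h hh.1⟩
  have hgh' : g⁻¹ * h = 1 := by
    refine DFunLike.coe_injective ?_
    rw [← hcomp g hg.1 h hh.1, hgh]
    rfl
  rw [inv_mul_eq_one] at hgh'
  exact hxy (by rw [hgh']; rfl)

/-! ### Orbits and their limit sets -/

lemma ballOrbit_subset_ball {n : ℕ} (Γ : Subgroup (Equiv.Perm (PoincareBall n)))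
    (z : PoincareBall n) : ballOrbit Γ z ⊆ Metric.ball 0 1 := by
  rintro _ ⟨g, -, rfl⟩
  exact (g z).2

lemma IsKleinian.finite_ballOrbit_inter {n : ℕ} {Γ : Subgroup (Equiv.Perm (PoincareBall n))}
    (hΓ : IsKleinian Γ) (z : PoincareBall n) {r : ℝ} (hr : r < 1) :
    (ballOrbit Γ z ∩ Metric.closedBall 0 r).Finite := by
  refine ((hΓ.finite_setOf_norm_le z hr).image
    fun g => (g z : EuclideanSpace ℝ (Fin n))).subset ?_
  rintro _ ⟨⟨g, hg, rfl⟩, hr⟩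
  exact ⟨g, ⟨hg, mem_closedBall_zero_iff.1 hr⟩, rfl⟩

/-- Each point of the ball has a neighbourhood meeting the orbit at most in that point. -/
lemma IsKleinian.exists_nhds_inter_subset {n : ℕ} {Γ : Subgroup (Equiv.Perm (PoincareBall n))}
    (hΓ : IsKleinian Γ) (z : PoincareBall n) {w : EuclideanSpace ℝ (Fin n)} (hw : ‖w‖ < 1) :
    ∃ U ∈ 𝓝 w, U ∩ ballOrbit Γ z ⊆ {w} := by
  obtain ⟨r, hwr, hr⟩ := exists_between hw
  have hfin := (hΓ.finite_ballOrbit_inter z hr).subset (Set.sdiff_subset (t := {w}))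
  refine ⟨Metric.ball 0 r ∩ ((ballOrbit Γ z ∩ Metric.closedBall 0 r) \ {w})ᶜ,
    inter_mem (Metric.isOpen_ball.mem_nhds (mem_ball_zero_iff.2 hwr))
      (hfin.isClosed.isOpen_compl.mem_nhds fun h => h.2 rfl), ?_⟩
  rintro x ⟨⟨hx1, hx2⟩, hx3⟩
  by_contra hne
  exact hx2 ⟨⟨hx3, Metric.ball_subset_closedBall hx1⟩, hne⟩

lemma IsKleinian.isDiscrete_ballOrbit {n : ℕ} {Γ : Subgroup (Equiv.Perm (PoincareBall n))}
    (hΓ : IsKleinian Γ) (z : PoincareBall n) : IsDiscrete (ballOrbit Γ z) := by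
  refine IsDiscrete.of_nhdsWithin fun x hx => ?_
  obtain ⟨U, hU, hUs⟩ :=
    hΓ.exists_nhds_inter_subset z (mem_ball_zero_iff.1 (ballOrbit_subset_ball Γ z hx))
  exact le_pure_iff.2 (mem_nhdsWithin_iff_exists_mem_nhds_inter.2 ⟨U, hU, hUs⟩)

lemma IsKleinian.mem_ballLimitSet_iff {n : ℕ} {Γ : Subgroup (Equiv.Perm (PoincareBall n))}
    (hΓ : IsKleinian Γ) {z : PoincareBall n} {w : EuclideanSpace ℝ (Fin n)} :
    w ∈ ballLimitSet (ballOrbit Γ z) ↔ w ∈ closure (ballOrbit Γ z) ∧ ‖w‖ = 1 := by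
  constructor
  · rintro ⟨hw, hwE⟩
    refine ⟨hw, le_antisymm ?_ ?_⟩
    · exact mem_closedBall_zero_iff.1 (closure_minimal
        ((ballOrbit_subset_ball Γ z).trans Metric.ball_subset_closedBall)
        Metric.isClosed_closedBall hw)
    · by_contra! hlt
      obtain ⟨U, hU, hUs⟩ := hΓ.exists_nhds_inter_subset z hlt
      obtain ⟨x, hx⟩ := mem_closure_iff_nhds.1 hw U hU
      exact hwE (hUs hx ▸ hx.2)
  · rintro ⟨hw, hw1⟩
    exact ⟨hw, fun h => (mem_ball_zero_iff.1 (ballOrbit_subset_ball Γ z h)).ne hw1⟩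

/-- The limit set does not depend on the base point of the orbit: the Euclidean distance between
`g z` and `g z'` tends to zero as these points approach the unit sphere. -/
lemma IsKleinian.ballLimitSet_subset {n : ℕ} {Γ : Subgroup (Equiv.Perm (PoincareBall n))}
    (hΓ : IsKleinian Γ) (z z' : PoincareBall n) :
    ballLimitSet (ballOrbit Γ z') ⊆ ballLimitSet (ballOrbit Γ z) := by
  intro w hw
  rw [hΓ.mem_ballLimitSet_iff] at hw ⊢
  refine ⟨?_, hw.2⟩
  obtain ⟨u, hu, hlim⟩ := mem_closure_iff_seq_limit.1 hw.1
  choose g hg hgu using hu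
  refine mem_closure_iff_seq_limit.2
    ⟨fun k => (g k z : EuclideanSpace ℝ (Fin n)), fun k => ⟨g k, hg k, rfl⟩, ?_⟩
  have hbound : ∀ k, ‖(g k z : EuclideanSpace ℝ (Fin n)) - u k‖ ≤
      √(pairInvariant (z : EuclideanSpace ℝ (Fin n)) z' * (1 - ‖u k‖ ^ 2)) := fun k => by
    refine Real.le_sqrt_of_sq_le ?_
    rw [hgu k, norm_sub_sq_eq_pairInvariant_mul (g k z).norm_lt_one (g k z').norm_lt_one,
      (hΓ.isConPlus _ (hg k)).preservesPairInvariant]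
    have h1 := one_sub_norm_sq_pos (g k z').norm_lt_one
    refine mul_le_mul_of_nonneg_left (mul_le_of_le_one_left h1.le ?_)
      (pairInvariant_nonneg z.norm_lt_one z'.norm_lt_one)
    nlinarith [norm_nonneg (g k z : EuclideanSpace ℝ (Fin n))]
  have hzero : Tendsto
      (fun k => √(pairInvariant (z : EuclideanSpace ℝ (Fin n)) z' * (1 - ‖u k‖ ^ 2)))
      atTop (𝓝 0) := by
    have := (((hlim.norm.pow 2).const_sub 1).const_mul
      (pairInvariant (z : EuclideanSpace ℝ (Fin n)) z')).sqrt
    simpa [hw.2] using this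
  simpa using (squeeze_zero_norm hbound hzero).add hlim

/-- If the limit point `a` stays away from the preimage of the centre under `g`, then `g` maps the
points of the orbit near `a` close to `g z`; these images accumulate at a limit point, the image
of `a` under the boundary extension of `g`. -/
lemma IsKleinian.exists_mem_ballLimitSet_norm_sub_le {n : ℕ}
    {Γ : Subgroup (Equiv.Perm (PoincareBall n))} (hΓ : IsKleinian Γ) {z : PoincareBall n}
    {a : EuclideanSpace ℝ (Fin n)} (ha : a ∈ ballLimitSet (ballOrbit Γ z))
    {g : Equiv.Perm (PoincareBall n)} (hg : g ∈ Γ) {η : ℝ} (hη : 0 < η)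
    (hap : η < ‖a - (g⁻¹ (ballCentre n) : EuclideanSpace ℝ (Fin n))‖) :
    ∃ w ∈ ballLimitSet (ballOrbit Γ z), ‖(g z : EuclideanSpace ℝ (Fin n)) - w‖ ≤
      4 / η * √((2 + 4 * pairInvariant (ballCentre n : EuclideanSpace ℝ (Fin n)) z) /
        (1 - ‖(z : EuclideanSpace ℝ (Fin n))‖ ^ 2)) *
        (1 - ‖(g z : EuclideanSpace ℝ (Fin n))‖) := by
  set p := g⁻¹ (ballCentre n) with hp
  set K := 2 + 4 * pairInvariant (ballCentre n : EuclideanSpace ℝ (Fin n)) z with hK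
  have hpres := (hΓ.isConPlus g hg).preservesPairInvariant
  have hgp : g p = ballCentre n := g.apply_symm_apply _
  have hz := one_sub_norm_sq_pos z.norm_lt_one
  have hx := one_sub_norm_sq_pos (g z).norm_lt_one
  have hK0 : 0 < K := by
    linarith [pairInvariant_nonneg (ballCentre n).norm_lt_one z.norm_lt_one]
  have hpK : 1 - ‖(p : EuclideanSpace ℝ (Fin n))‖ ^ 2 ≤
      K * (1 - ‖(g z : EuclideanSpace ℝ (Fin n))‖ ^ 2) := by
    rw [hpres.norm_preimage_centre hgp, hK, ← hpres (ballCentre n) z]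
    exact one_sub_norm_sq_le_mul (g _).norm_lt_one (g z).norm_lt_one
  obtain ⟨hac, ha1⟩ := hΓ.mem_ballLimitSet_iff.1 ha
  -- Points of the orbit close to `a` are mapped by `g` close to `g z`, and close to the sphere.
  have hnear : ∀ u : PoincareBall n, η < ‖(u : EuclideanSpace ℝ (Fin n)) - p‖ →
      (1 - ‖(g u : EuclideanSpace ℝ (Fin n))‖ ^ 2) * η ^ 2 ≤
        1 - ‖(u : EuclideanSpace ℝ (Fin n))‖ ^ 2 ∧
      ‖(g z : EuclideanSpace ℝ (Fin n)) - g u‖ ≤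
        4 / η * √(K / (1 - ‖(z : EuclideanSpace ℝ (Fin n))‖ ^ 2)) *
          (1 - ‖(g z : EuclideanSpace ℝ (Fin n))‖) := by
    intro u hu
    have hu0 := one_sub_norm_sq_pos u.norm_lt_one
    have hgu := one_sub_norm_sq_pos (g u).norm_lt_one
    have hp0 := one_sub_norm_sq_pos p.norm_lt_one
    have h1 : (1 - ‖(g u : EuclideanSpace ℝ (Fin n))‖ ^ 2) * η ^ 2 ≤
        (1 - ‖(u : EuclideanSpace ℝ (Fin n))‖ ^ 2) *
          (1 - ‖(p : EuclideanSpace ℝ (Fin n))‖ ^ 2) := by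
      refine le_trans ?_ (hpres.one_sub_norm_sq_mul_le hgp u)
      gcongr
    refine ⟨h1.trans (mul_le_of_le_one_right hu0.le 
      (sub_le_self _ (sq_nonneg _))), ?_⟩
    have hx' : 1 - ‖(g z : EuclideanSpace ℝ (Fin n))‖ ^ 2 ≤
        2 * (1 - ‖(g z : EuclideanSpace ℝ (Fin n))‖) := by
      nlinarith [sq_nonneg (1 - ‖(g z : EuclideanSpace ℝ (Fin n))‖)]
    have h2 : ‖(z : EuclideanSpace ℝ (Fin n)) - u‖ ^ 2 ≤ 4 := by
      have : ‖(z : EuclideanSpace ℝ (Fin n)) - u‖ ≤ 2 :=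
        (norm_sub_le _ _).trans (by linarith [u.norm_lt_one, z.norm_lt_one])
      nlinarith [norm_nonneg ((z : EuclideanSpace ℝ (Fin n)) - u)]
    have h3 : ‖(g z : EuclideanSpace ℝ (Fin n)) - g u‖ ^ 2 ≤
        (4 / η * √(K / (1 - ‖(z : EuclideanSpace ℝ (Fin n))‖ ^ 2)) *
          (1 - ‖(g z : EuclideanSpace ℝ (Fin n))‖)) ^ 2 := by
      rw [mul_pow, mul_pow, Real.sq_sqrt (by positivity),
        norm_sub_sq_eq_pairInvariant_mul (g z).norm_lt_one (g u).norm_lt_one, hpres z u,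
        pairInvariant]
      generalize ‖(z : EuclideanSpace ℝ (Fin n)) - u‖ ^ 2 = d at *
      generalize 1 - ‖(z : EuclideanSpace ℝ (Fin n))‖ ^ 2 = Z at *
      generalize 1 - ‖(u : EuclideanSpace ℝ (Fin n))‖ ^ 2 = A at *
      generalize 1 - ‖(g u : EuclideanSpace ℝ (Fin n))‖ ^ 2 = B at *
      generalize 1 - ‖(p : EuclideanSpace ℝ (Fin n))‖ ^ 2 = P at *
      generalize 1 - ‖(g z : EuclideanSpace ℝ (Fin n))‖ ^ 2 = X at *
      generalize 1 - ‖(g z : EuclideanSpace ℝ (Fin n))‖ = Y at *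
      have hB : B ≤ A * P / η ^ 2 := (le_div_iff₀ (by positivity)).2 h1
      calc d / (Z * A) * (X * B) ≤ 4 / (Z * A) * (X * (A * (K * X) / η ^ 2)) := by
            gcongr
            exact hB.trans (by gcongr)
        _ = 4 * K / (Z * η ^ 2) * X ^ 2 := by field_simp
        _ ≤ 4 * K / (Z * η ^ 2) * (2 * Y) ^ 2 := by gcongr
        _ = (4 / η) ^ 2 * (K / Z) * Y ^ 2 := by
            field_simp
            ring
    have hY : 0 ≤ 1 - ‖(g z : EuclideanSpace ℝ (Fin n))‖ := by linarith [(g z).norm_lt_one]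
    exact (pow_le_pow_iff_left₀ (norm_nonneg _) (by positivity) two_ne_zero).1 h3
  obtain ⟨u, hu, hlim⟩ := mem_closure_iff_seq_limit.1 hac
  choose h hh hhu using hu
  obtain ⟨w, -, φ, hφ, hw⟩ := (isCompact_closedBall (0 : EuclideanSpace ℝ (Fin n)) 1).tendsto_subseq
    (x := fun k => (g (h k z) : EuclideanSpace ℝ (Fin n)))
    fun k => Metric.ball_subset_closedBall (g (h k z)).2
  have hlim' : Tendsto (fun k => (h (φ k) z : EuclideanSpace ℝ (Fin n))) atTop (𝓝 a) := by
    simp only [← hhu]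
    exact hlim.comp hφ.tendsto_atTop
  have hev : ∀ᶠ k in atTop, η < ‖(h (φ k) z : EuclideanSpace ℝ (Fin n)) - p‖ :=
    (hlim'.sub_const _).norm.eventually_const_lt hap
  have hwc : w ∈ closure (ballOrbit Γ z) := mem_closure_of_tendsto hw
    (Eventually.of_forall fun k => ⟨g * h (φ k), Γ.mul_mem hg (hh _), rfl⟩)
  refine ⟨w, hΓ.mem_ballLimitSet_iff.2 ⟨hwc, le_antisymm ?_ ?_⟩, ?_⟩
  · exact mem_closedBall_zero_iff.1 (closure_minimal
      ((ballOrbit_subset_ball Γ z).trans Metric.ball_subset_closedBall)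
      Metric.isClosed_closedBall hwc)
  · have h1 : (1 - ‖w‖ ^ 2) * η ^ 2 ≤ 1 - ‖a‖ ^ 2 :=
      le_of_tendsto_of_tendsto (((hw.norm.pow 2).const_sub 1).mul_const _)
        ((hlim'.norm.pow 2).const_sub 1) (hev.mono fun k hk => (hnear _ hk).1)
    rw [ha1, one_pow, sub_self] at h1
    have h2 : 1 - ‖w‖ ^ 2 ≤ 0 := nonpos_of_mul_nonpos_left h1 (by positivity)
    nlinarith [norm_nonneg w]
  · exact le_of_tendsto (hw.const_sub _).norm (hev.mono fun k hk => (hnear _ hk).2)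

theorem mainTheorem8 (n : ℕ) (Γ : Subgroup (Equiv.Perm (PoincareBall n)))
    (hΓ : IsKleinian Γ) (hne : IsNonElementary Γ) (z : PoincareBall n) :
    IsWellApproximated (ballOrbit Γ z) := by
  obtain ⟨a, b, ha, hb, hab⟩ := Set.one_lt_encard_iff.1 (lt_trans (by norm_num) hne)
  have ha' := hΓ.ballLimitSet_subset z _ ha
  have hb' := hΓ.ballLimitSet_subset z _ hb
  have hd : 0 < ‖a - b‖ := norm_pos_iff.2 (sub_ne_zero.2 hab)
  have hη : 0 < ‖a - b‖ / 3 := by positivity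
  refine ⟨ballOrbit_subset_ball Γ z, hΓ.isDiscrete_ballOrbit z, max 1 (4 / (‖a - b‖ / 3) *
      √((2 + 4 * pairInvariant (ballCentre n : EuclideanSpace ℝ (Fin n)) z) /
        (1 - ‖(z : EuclideanSpace ℝ (Fin n))‖ ^ 2))), le_max_left _ _, ?_⟩
  rintro _ ⟨g, hg, rfl⟩
  have hY : 0 ≤ 1 - ‖(g z : EuclideanSpace ℝ (Fin n))‖ := by linarith [(g z).norm_lt_one]
  -- The preimage of the centre cannot be close to both `a` and `b`.
  have hfar : ∃ w ∈ ballLimitSet (ballOrbit Γ z),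
      ‖a - b‖ / 3 < ‖w - (g⁻¹ (ballCentre n) : EuclideanSpace ℝ (Fin n))‖ := by
    by_contra! hcon
    have h1 := hcon a ha'
    have h2 := hcon b hb'
    have h3 := norm_sub_le_norm_sub_add_norm_sub a
      (g⁻¹ (ballCentre n) : EuclideanSpace ℝ (Fin n)) b
    rw [norm_sub_rev (g⁻¹ (ballCentre n) : EuclideanSpace ℝ (Fin n)) b] at h3
    linarith
  obtain ⟨a₁, ha₁, hη₁⟩ := hfar
  obtain ⟨w, hw, hwx⟩ := hΓ.exists_mem_ballLimitSet_norm_sub_le ha₁ hg hη hη₁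
  exact ⟨w, hw, hwx.trans (mul_le_mul_of_nonneg_right (le_max_right _ _) hY)⟩
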